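/- Let $d\ge 0$, let $S$ be a finite set and let $p(a\,|\,\eta)$, $a\in S$, $\eta\in S^{\{-1,0,1\}^d}$, satisfy $0<p(a|\eta)<1$ and $\sum_{a}p(a|\eta)=1$. Consider the translation-invariant nearest-neighbour probabilistic cellular automaton (PCA) on $S^{\mathbb Z^d}$ in which, given the configuration $\xi$ at time $n-1$, all sites are updated independently and site $i$ takes the value $a$ at time $n$ with probability $p_i(a|\xi)=p\big(a\,|\,(\xi(i+e))_{|e|\le 1}\big)$, where $|i|=\max_k|i_k|$. Let $\rho$ be a translation-invariant stationary probability measure of the PCA and let $\mu$ be its Markov extension, i.e. the law on space-time configurations $\sigma\in S^{\mathbb Z^d\times\mathbb Z}$ of the two-sided stationary process whose layers $\sigma(\cdot,n)$ all have law $\rho$ and in which, given all layers before time $n$, the layer at time $n$ is drawn by the rule above from the layer at time $n-1$. Put $$J_{i,n}(\sigma)=\ln p_i(\sigma(i,n)\,|\,\sigma(\cdot,n-1))-\ln p_i(\sigma(i,n-1)\,|\,\sigma(\cdot,n)),$$ $$\Lambda_{L,N}=\{(i,n)\in\mathbb Z^d\times\mathbb Z:\ |i|\le L,\ |n|\le N\}.$$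 (1) There is a function $e:\mathbb R\to\mathbb R$ such that, for every sequence $L=L(N)\le N$ with $L(N)\to\infty$ as $N\to\infty$ and every real $\lambda$, $$-\lim_{N\to\infty}\frac1{|\Lambda_{L,N}|}\ln\mu\Big(\exp\Big[-\lambda\sum_{(i,n)\in\Lambda_{L-1,N-1}}J_{i,n}\Big]\Big)=e(\lambda),$$ and $e(\lambda)=e(1-\lambda)$ for all real $\lambda$. (2) For integers $1\le L\le N$ and real $\lambda$ put $$e_{L,N}(\lambda)=-\frac1N\ln\mu\Big(\exp\Big[-\lambda\sum_{(i,n)\in\Lambda_{L-1,N-1}}J_{i,n}\Big]\Big).$$ There are constants $c(\lambda,d)$ and $c'(\lambda,d)$, depending only on $\lambda$, $d$ and the transition probabilities $p$, such that for all $L\ge1$, uniformly in $N\ge L$, $$|e_{L,N}(\lambda)|\le c'(\lambda,d)\,L^{d},\qquad |e_{L,N}(\lambda)-e_{L,N}(1-\lambda)|\le c(\lambda,d)\,L^{d-1}.$$ -/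

import Mathlib

open MeasureTheory ProbabilityTheory Filter Topology

noncomputable section

/-- The offsets `e ∈ ℤ^d` with `max_k |e_k| ≤ 1`: the neighbourhood of the origin. -/
abbrev Nbr (d : ℕ) : Type := {e : Fin d → ℤ // ∀ k, |e k| ≤ 1}

/-- Spatial configurations `ξ : ℤ^d → S`, with the product sigma-algebra. -/
abbrev SpaceConfig (d : ℕ) (S : Type*) : Type _ := (Fin d → ℤ) → S

/-- Space-time configurations `σ : ℤ^d × ℤ → S`, with the product sigma-algebra.
A space-time point is `x = (i, n)` with site `i` and time `n`. -/
abbrev Config (d : ℕ) (S : Type*) : Type _ := (Fin d → ℤ) × ℤ → S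

/-- A time-homogeneous, translation-invariant nearest-neighbour probabilistic cellular automaton
on `ℤ^d` with finite single-site space `S`: `prob a η` is the probability that a site takes the
value `a` when its neighbourhood was in the configuration `η` one time step before. -/
structure PCA (d : ℕ) (S : Type*) [Fintype S] where
  prob : S → (Nbr d → S) → ℝ
  pos : ∀ a η, 0 < prob a η
  lt_one : ∀ a η, prob a η < 1
  sum_eq_one : ∀ η, ∑ a, prob a η = 1

/-- The restriction of a space-time configuration to the layer at time `n`. -/
def layer {d : ℕ} {S : Type*} (n : ℤ) (σ : Config d S) : SpaceConfig d S := fun i => σ (i, n)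

/-- The box `Λ_{L,N}` of the `(i, n)` with `max_k |i_k| ≤ L` and `|n| ≤ N`. -/
def box (d : ℕ) (L N : ℤ) : Finset ((Fin d → ℤ) × ℤ) :=
  Fintype.piFinset (fun _ : Fin d => Finset.Icc (-L) L) ×ˢ Finset.Icc (-N) N

/-- The law `ρ` on spatial configurations is invariant under all spatial translations. -/
def IsTranslationInvariant {d : ℕ} {S : Type*} [MeasurableSpace S]
    (ρ : Measure (SpaceConfig d S)) : Prop :=
  ∀ j : Fin d → ℤ, ρ.map (fun ξ i => ξ (i + j)) = ρ

namespace PCA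

variable {d : ℕ} {S : Type*} [Fintype S]

/-- `p_i(a | ξ)`: the probability of the value `a` at site `i`, given the previous layer `ξ`. -/
def trans (P : PCA d S) (i : Fin d → ℤ) (a : S) (ξ : SpaceConfig d S) : ℝ :=
  P.prob a (fun e => ξ (i + e.1))

/-- `ρ` is stationary: one step of the dynamics, in which the sites are updated independently
given the previous layer, preserves `ρ` (tested on all cylinder events). -/
def IsStationary [MeasurableSpace S] (P : PCA d S) (ρ : Measure (SpaceConfig d S)) : Prop :=
  ∀ (V : Finset (Fin d → ℤ)) (a : (Fin d → ℤ) → S),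
    ρ.real {ξ | ∀ i ∈ V, ξ i = a i} = ∫ ξ, ∏ i ∈ V, P.trans i (a i) ξ ∂ρ

/-- `μ` is the law of the two-sided Markov process of the automaton with all its layers
distributed according to `ρ`. -/
structure IsMarkovExtension [MeasurableSpace S] (P : PCA d S)
    (ρ : Measure (SpaceConfig d S)) (μ : Measure (Config d S)) : Prop where
  /-- every layer has law `ρ` -/
  map_layer : ∀ n : ℤ, μ.map (layer n) = ρ
  /-- given all layers before time `n`, the sites of layer `n` are updated independently with the
  transition probabilities of the automaton -/
  markov : ∀ (n : ℤ) (V : Finset (Fin d → ℤ)) (a : (Fin d → ℤ) → S),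
    μ⟦{σ : Config d S | ∀ i ∈ V, σ (i, n) = a i} |
        cylinderEvents {x : (Fin d → ℤ) × ℤ | x.2 < n}⟧
      =ᵐ[μ] fun σ => ∏ i ∈ V, P.trans i (a i) (layer (n - 1) σ)

/-- The time-reversal current `J_{i,n}(σ)` at the space-time point `x = (i, n)`. -/
def current (P : PCA d S) (x : (Fin d → ℤ) × ℤ) (σ : Config d S) : ℝ :=
  Real.log (P.trans x.1 (σ (x.1, x.2)) (layer (x.2 - 1) σ)) -
    Real.log (P.trans x.1 (σ (x.1, x.2 - 1)) (layer x.2 σ))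

/-- `ln μ(exp[-lam ∑ J_{i,n}])`, with the sum over `(i, n) ∈ Λ_{L-1,N-1}`. -/
def logGen [MeasurableSpace S] (P : PCA d S) (μ : Measure (Config d S)) (L N : ℕ) (lam : ℝ) : ℝ :=
  Real.log (∫ σ, Real.exp (-lam * ∑ x ∈ box d ((L : ℤ) - 1) ((N : ℤ) - 1), P.current x σ) ∂μ)

/-- The finite-time quantity `e_{L,N}(lam) = -N⁻¹ ln μ(exp[-lam ∑ J_{i,n}])`. -/
def eLN [MeasurableSpace S] (P : PCA d S) (μ : Measure (Config d S)) (L N : ℕ) (lam : ℝ) : ℝ :=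
  -(1 / (N : ℝ)) * P.logGen μ L N lam

end PCA

end

/-! The path weight of the automaton is `exp (∑ logForward)`, and multiplying it by `exp (-lam * ∑
J)` gives `exp (∑ tilted lam)`, where `tilted lam` is `1 - lam` times the forward plus `lam` times
the backward log transition probability. This interaction is bounded, of finite range and
translation invariant. The generating function of the current is therefore, up to boundary effects,
its partition function over the uniform product measure.

The boundary effects come from the first layer and from sites whose neighbourhood leaves the box.
Each such factor lies between `exp (-K)` and `1`, by positivity of the finitely many transition
probabilities, so the logarithms differ by at most `K * boundaryCount d L N`
(`measureReal_agreeOn_bounds`, `abs_logGen_sub_le`). No property of `ρ` enters this error.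

Reflection of time exchanges forward and backward transitions, hence `lam` and `1 - lam`, and
preserves the product measure, so the partition functions at `lam` and `1 - lam` are equal
(`logPartition_tilted_symm`). The symmetry of the generating function then holds up to the boundary
error, which is negligible per volume and of order `N * L ^ (d - 1)` when `L ≤ N`.

The limit per volume exists by packing the box with separated cubes, over which the partition
function factorizes exactly (`logPartition_biUnion_block`). The points left over cost a bounded
amount each, and their density tends to zero as the cubes grow. -/

noncomputable section

/-! ### Functions of finitely many coordinates and their partition functions -/

section FiniteRange

variable {ι S : Type*}

lemma DependsOn.eq_comp_restrict [Nonempty S] {f : (ι → S) → ℝ} {B : Finset ι}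
    (hf : DependsOn f B) : ∃ g : (B → S) → ℝ, f = g ∘ B.restrict :=
  dependsOn_iff_exists_comp.1 hf

lemma DependsOn.finset_prod {τ : Type*} [DecidableEq ι] {T : Finset τ} {D : τ → Finset ι}
    {f : τ → (ι → S) → ℝ} (hf : ∀ t ∈ T, DependsOn (f t) (D t)) :
    DependsOn (fun σ => ∏ t ∈ T, f t σ) (T.biUnion D) := fun _ _ h =>
  Finset.prod_congr rfl fun t ht => hf t ht fun y hy =>
    h y (Finset.mem_coe.2 (Finset.mem_biUnion.2 ⟨t, ht, hy⟩))

lemma DependsOn.exp_sum [DecidableEq ι] {h : ι → (ι → S) → ℝ} {D : ι → Finset ι}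
    {A : Finset ι} (hD : ∀ x ∈ A, DependsOn (h x) (D x)) :
    DependsOn (fun σ => Real.exp (∑ x ∈ A, h x σ)) (A.biUnion D) := fun σ σ' hσ => by
  refine congrArg Real.exp (Finset.sum_congr rfl fun x hx => hD x hx fun y hy => hσ y ?_)
  exact Finset.mem_coe.2 (Finset.mem_biUnion.2 ⟨x, hx, hy⟩)

/-- A product of identical measures is invariant under permutations of the coordinates. -/
lemma integral_comp_perm_infinitePi [MeasurableSpace S] (π : Measure S) [IsProbabilityMeasure π]
    (e : ι ≃ ι) {f : (ι → S) → ℝ} (hf : Measurable f) :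
    ∫ σ, f (fun y => σ (e y)) ∂(Measure.infinitePi fun _ : ι => π) =
      ∫ σ, f σ ∂(Measure.infinitePi fun _ : ι => π) := by
  have h := Measure.map_infinitePi_infinitePi_of_inj (P := fun _ : ι => π) e.injective
  conv_rhs => rw [← h]
  rw [integral_map (measurable_pi_lambda _ fun y => measurable_pi_apply (e y)).aemeasurable
    hf.aestronglyMeasurable]

variable [Finite S] [MeasurableSpace S] [MeasurableSingletonClass S]

lemma DependsOn.measurable_of_finite [Nonempty S] {f : (ι → S) → ℝ} {B : Finset ι}
    (hf : DependsOn f B) : Measurable f := by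
  obtain ⟨g, rfl⟩ := hf.eq_comp_restrict
  exact (Measurable.of_discrete).comp (Finset.measurable_restrict B)

lemma DependsOn.integrable_of_finite [Nonempty S] {f : (ι → S) → ℝ} {B : Finset ι}
    (hf : DependsOn f B) (μ : Measure (ι → S)) [IsFiniteMeasure μ] : Integrable f μ := by
  have hm := hf.measurable_of_finite
  obtain ⟨g, rfl⟩ := hf.eq_comp_restrict
  obtain ⟨C, hC⟩ := (Set.finite_range fun x => ‖g x‖).bddAbove
  exact Integrable.of_bound hm.aestronglyMeasurable C
    (ae_of_all _ fun σ => hC ⟨B.restrict σ, rfl⟩)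

/-- A function of finitely many coordinates is integrated by summing over the cylinders. -/
lemma DependsOn.integral_eq_sum [Nonempty S] [DecidableEq ι] [Fintype S] {f : (ι → S) → ℝ}
    {B : Finset ι} (hf : DependsOn f B) (σ₀ : ι → S) (μ : Measure (ι → S)) [IsFiniteMeasure μ] :
    ∫ σ, f σ ∂μ = ∑ η : B → S, μ.real {σ | ∀ y ∈ B, σ y = Function.updateFinset σ₀ B η y} *
      f (Function.updateFinset σ₀ B η) := by
  have hint := hf.integrable_of_finite μ
  obtain ⟨g, rfl⟩ := hf.eq_comp_restrict
  -- `σ₀` is an arbitrary filling off `B`, which `f` does not see.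
  have hr : ∀ η : B → S, B.restrict (Function.updateFinset σ₀ B η) = η := fun η => by
    ext y; simp [Function.updateFinset]
  have hm := Finset.measurable_restrict (X := fun _ : ι => S) B
  have h1 : ∫ σ, (g ∘ B.restrict) σ ∂μ = ∫ η, g η ∂(μ.map B.restrict) :=
    (integral_map hm.aemeasurable Measurable.of_discrete.aestronglyMeasurable).symm
  rw [h1, integral_fintype Integrable.of_finite]
  refine Finset.sum_congr rfl fun η _ => ?_
  rw [map_measureReal_apply hm (measurableSet_singleton _), smul_eq_mul, Function.comp_apply, hr]
  congr 2
  ext σ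
  simp only [Set.mem_preimage, Set.mem_singleton_iff, Set.mem_ofPred_eq, funext_iff,
    Subtype.forall, Finset.restrict]
  refine forall₂_congr fun y hy => ?_
  simp [Function.updateFinset, hy]

/-- Under a product measure, functions of disjoint finite sets of coordinates are independent. -/
lemma integral_prod_of_dependsOn [Nonempty S] {τ : Type*} (π : ι → Measure S)
    [∀ i, IsProbabilityMeasure (π i)] (T : Finset τ) (D : τ → Finset ι)
    (hD : (T : Set τ).PairwiseDisjoint D) (f : τ → (ι → S) → ℝ)
    (hf : ∀ t ∈ T, DependsOn (f t) (D t)) :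
    ∫ σ, ∏ t ∈ T, f t σ ∂(Measure.infinitePi π) =
      ∏ t ∈ T, ∫ σ, f t σ ∂(Measure.infinitePi π) := by
  classical
  induction T using Finset.induction_on with
  | empty => simp
  | insert a T ha ih =>
    simp only [Finset.prod_insert ha]
    rw [← ih (hD.subset (by simp)) fun t ht => hf t (Finset.mem_insert_of_mem ht)]
    have hT : DependsOn (fun σ => ∏ t ∈ T, f t σ) (T.biUnion D) :=
      DependsOn.finset_prod fun t ht => hf t (Finset.mem_insert_of_mem ht)
    have hdisj : Disjoint (D a) (T.biUnion D) := by
      rw [Finset.disjoint_biUnion_right]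
      intro t ht
      exact hD (by simp) (by simp [ht]) (by rintro rfl; exact ha ht)
    have hind : IndepFun (fun (σ : ι → S) (i : D a) => σ i)
        (fun (σ : ι → S) (i : T.biUnion D) => σ i) (Measure.infinitePi π) :=
      (iIndepFun_infinitePi (P := π) (X := fun _ s => s)
        (fun _ => measurable_id)).indepFun_finset _ _ hdisj (fun i => measurable_pi_apply i)
    obtain ⟨g₁, hg₁⟩ := (hf a (by simp)).eq_comp_restrict
    obtain ⟨g₂, hg₂⟩ := hT.eq_comp_restrict
    have h12 := hind.comp (φ := g₁) (ψ := g₂) Measurable.of_discrete Measurable.of_discrete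
    have e1 : g₁ ∘ (fun (σ : ι → S) (i : D a) => σ i) = f a := hg₁.symm
    have e2 : g₂ ∘ (fun (σ : ι → S) (i : T.biUnion D) => σ i) = fun σ => ∏ t ∈ T, f t σ :=
      hg₂.symm
    rw [e1, e2] at h12
    exact h12.integral_fun_mul_eq_mul_integral
      (hf a (by simp)).measurable_of_finite.aestronglyMeasurable
      hT.measurable_of_finite.aestronglyMeasurable

/-- The logarithm of the exponential moment of `∑ x ∈ A, h x`. -/
def logPartition (ν : Measure (ι → S)) (h : ι → (ι → S) → ℝ) (A : Finset ι) : ℝ :=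
  Real.log (∫ σ, Real.exp (∑ x ∈ A, h x σ) ∂ν)

/-- Dropping a point changes the exponent by at most `C`, uniformly in the configuration, and such a
bound passes through the integral and the logarithm. -/
lemma logPartition_sub_le [Nonempty S] (ν : Measure (ι → S)) [IsProbabilityMeasure ν]
    {h : ι → (ι → S) → ℝ} {D : ι → Finset ι} (hD : ∀ x, DependsOn (h x) (D x)) {C : ℝ}
    (hC : ∀ x σ, |h x σ| ≤ C) {A B : Finset ι} (hAB : A ⊆ B) :
    |logPartition ν h B - logPartition ν h A| ≤ C * ((B.card : ℝ) - A.card) := by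
  classical
  have hint : ∀ A : Finset ι, Integrable (fun σ => Real.exp (∑ x ∈ A, h x σ)) ν := fun A =>
    (DependsOn.exp_sum fun x _ => hD x).integrable_of_finite ν
  have hpos : ∀ A : Finset ι, 0 < ∫ σ, Real.exp (∑ x ∈ A, h x σ) ∂ν := fun A =>
    integral_exp_pos (hint A)
  have hcard : ((B \ A).card : ℝ) = (B.card : ℝ) - A.card := by
    rw [Finset.card_sdiff_of_subset hAB, Nat.cast_sub (Finset.card_le_card hAB)]
  have hdiff : ∀ σ, |∑ x ∈ B \ A, h x σ| ≤ C * ((B.card : ℝ) - A.card) := fun σ => by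
    calc |∑ x ∈ B \ A, h x σ| ≤ ∑ x ∈ B \ A, |h x σ| := Finset.abs_sum_le_sum_abs _ _
      _ ≤ ∑ x ∈ B \ A, C := Finset.sum_le_sum fun x _ => hC x σ
      _ = C * ((B.card : ℝ) - A.card) := by rw [Finset.sum_const, nsmul_eq_mul, hcard, mul_comm]
  set R := C * ((B.card : ℝ) - A.card)
  have hsum : ∀ σ, ∑ x ∈ B, h x σ = ∑ x ∈ B \ A, h x σ + ∑ x ∈ A, h x σ := fun σ =>
    (Finset.sum_sdiff hAB).symm
  have key : ∀ (A B : Finset ι), (∀ σ, ∑ x ∈ B, h x σ ≤ R + ∑ x ∈ A, h x σ) →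
      logPartition ν h B ≤ R + logPartition ν h A := fun A B hle => by
    rw [logPartition, logPartition, ← Real.log_exp R,
      ← Real.log_mul (Real.exp_pos _).ne' (hpos A).ne', ← integral_const_mul]
    refine Real.log_le_log (hpos B) (integral_mono (hint B) ((hint A).const_mul _) fun σ => ?_)
    simp only [← Real.exp_add]
    exact Real.exp_le_exp.2 (hle σ)
  rw [abs_sub_le_iff]
  constructor
  · have := key A B fun σ => by
      rw [hsum σ]; linarith [le_abs_self (∑ x ∈ B \ A, h x σ), hdiff σ]
    linarith
  · have := key B A fun σ => by
      rw [hsum σ]; linarith [neg_abs_le (∑ x ∈ B \ A, h x σ), hdiff σ]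
    linarith

end FiniteRange

/-! ### The tilted interaction: locality, bounds and symmetries -/

instance nbr_finite (d : ℕ) : Finite (Nbr d) := by
  refine Finite.of_injective
    (fun e : Nbr d => fun k => (⟨e.1 k, Finset.mem_Icc.2 (abs_le.1 (e.2 k))⟩ : Finset.Icc (-1 : ℤ) 1))
    fun e e' h => Subtype.ext (funext fun k => ?_)
  exact congrArg Subtype.val (congrFun h k)

/-- The space-time points on which the forward and backward transitions at `x` depend. -/
def transitionNbhd {d : ℕ} (x : (Fin d → ℤ) × ℤ) : Finset ((Fin d → ℤ) × ℤ) :=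
  Fintype.piFinset (fun k => Finset.Icc (x.1 k - 1) (x.1 k + 1)) ×ˢ Finset.Icc (x.2 - 1) x.2

lemma mem_transitionNbhd {d : ℕ} {x y : (Fin d → ℤ) × ℤ} :
    y ∈ transitionNbhd x ↔
      (∀ k, x.1 k - 1 ≤ y.1 k ∧ y.1 k ≤ x.1 k + 1) ∧ x.2 - 1 ≤ y.2 ∧ y.2 ≤ x.2 := by
  simp [transitionNbhd]

lemma nbr_add_mem_transitionNbhd {d : ℕ} (x : (Fin d → ℤ) × ℤ) (e : Nbr d) {n : ℤ}
    (h1 : x.2 - 1 ≤ n) (h2 : n ≤ x.2) : (x.1 + e.1, n) ∈ transitionNbhd x := by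
  refine mem_transitionNbhd.2 ⟨fun k => ?_, h1, h2⟩
  have := abs_le.1 (e.2 k)
  simp only [Pi.add_apply]
  constructor <;> linarith

lemma mem_transitionNbhd_of_fst_eq {d : ℕ} (x : (Fin d → ℤ) × ℤ) {n : ℤ}
    (h1 : x.2 - 1 ≤ n) (h2 : n ≤ x.2) : (x.1, n) ∈ transitionNbhd x :=
  mem_transitionNbhd.2 ⟨fun k => ⟨by simp, by simp⟩, h1, h2⟩

namespace PCA

variable {d : ℕ} {S : Type*} [Fintype S] (P : PCA d S)

/-- The logarithm of the transition probability into the space-time point `x`. -/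
def logForward (x : (Fin d → ℤ) × ℤ) (σ : Config d S) : ℝ :=
  Real.log (P.trans x.1 (σ (x.1, x.2)) (layer (x.2 - 1) σ))

/-- The logarithm of the transition probability into `x` for the time-reversed configuration. -/
def logBackward (x : (Fin d → ℤ) × ℤ) (σ : Config d S) : ℝ :=
  Real.log (P.trans x.1 (σ (x.1, x.2 - 1)) (layer x.2 σ))

/-- The interaction interpolating between the forward and the backward process. -/
def tilted (lam : ℝ) (x : (Fin d → ℤ) × ℤ) (σ : Config d S) : ℝ :=
  (1 - lam) * P.logForward x σ + lam * P.logBackward x σ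

lemma trans_pos (i : Fin d → ℤ) (a : S) (ξ : SpaceConfig d S) : 0 < P.trans i a ξ := P.pos _ _

lemma trans_le_one (i : Fin d → ℤ) (a : S) (ξ : SpaceConfig d S) : P.trans i a ξ ≤ 1 :=
  (P.lt_one _ _).le

/-- By translation invariance only finitely many positive numbers occur. The maximum with `0` keeps
`K` nonnegative even for empty `S`. -/
lemma exists_log_trans_bound :
    ∃ K : ℝ, 0 ≤ K ∧ ∀ i a ξ, -K ≤ Real.log (P.trans i a ξ) := by
  obtain ⟨C, hC⟩ :=
    (Set.finite_range fun q : S × (Nbr d → S) => -Real.log (P.prob q.1 q.2)).bddAbove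
  refine ⟨max C 0, le_max_right _ _, fun i a ξ => ?_⟩
  have := hC ⟨(a, fun e => ξ (i + e.1)), rfl⟩
  simp only [trans]
  linarith [le_max_left C 0]

lemma log_trans_nonpos (i : Fin d → ℤ) (a : S) (ξ : SpaceConfig d S) :
    Real.log (P.trans i a ξ) ≤ 0 :=
  Real.log_nonpos (P.trans_pos i a ξ).le (P.trans_le_one i a ξ)

lemma abs_log_trans_le {K : ℝ} (hK : ∀ i a ξ, -K ≤ Real.log (P.trans i a ξ))
    (i : Fin d → ℤ) (a : S) (ξ : SpaceConfig d S) : |Real.log (P.trans i a ξ)| ≤ K := by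
  have h1 := hK i a ξ
  have h2 := P.log_trans_nonpos i a ξ
  exact abs_le.2 ⟨h1, by linarith⟩

lemma logForward_dependsOn (x : (Fin d → ℤ) × ℤ) :
    DependsOn (P.logForward x) (transitionNbhd x) := fun σ σ' h => by
  simp only [logForward, trans, layer]
  rw [h _ (mem_transitionNbhd_of_fst_eq x (by simp) le_rfl)]
  congr 3
  exact funext fun e => h _ (nbr_add_mem_transitionNbhd x e le_rfl (by simp))

lemma logBackward_dependsOn (x : (Fin d → ℤ) × ℤ) :
    DependsOn (P.logBackward x) (transitionNbhd x) := fun σ σ' h => by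
  simp only [logBackward, trans, layer]
  rw [h _ (mem_transitionNbhd_of_fst_eq x le_rfl (by simp))]
  congr 3
  exact funext fun e => h _ (nbr_add_mem_transitionNbhd x e (by simp) le_rfl)

lemma current_dependsOn (x : (Fin d → ℤ) × ℤ) :
    DependsOn (P.current x) (transitionNbhd x) := fun _ _ h =>
  congrArg₂ (· - ·) (P.logForward_dependsOn x h) (P.logBackward_dependsOn x h)

lemma tilted_dependsOn (lam : ℝ) (x : (Fin d → ℤ) × ℤ) :
    DependsOn (P.tilted lam x) (transitionNbhd x) := fun σ σ' h => by
  rw [tilted, tilted, P.logForward_dependsOn x h, P.logBackward_dependsOn x h]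

lemma abs_tilted_le {K : ℝ} (hK : ∀ i a ξ, -K ≤ Real.log (P.trans i a ξ)) (lam : ℝ)
    (x : (Fin d → ℤ) × ℤ) (σ : Config d S) : |P.tilted lam x σ| ≤ (|1 - lam| + |lam|) * K := by
  have hf : |P.logForward x σ| ≤ K := P.abs_log_trans_le hK _ _ _
  have hb : |P.logBackward x σ| ≤ K := P.abs_log_trans_le hK _ _ _
  calc |P.tilted lam x σ| ≤ |(1 - lam) * P.logForward x σ| + |lam * P.logBackward x σ| :=
        abs_add_le _ _
    _ = |1 - lam| * |P.logForward x σ| + |lam| * |P.logBackward x σ| := by rw [abs_mul, abs_mul]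
    _ ≤ |1 - lam| * K + |lam| * K := by gcongr
    _ = _ := by ring

/-- Both logarithms lie in `[-K, 0]`, so their difference is bounded by `K` and not just by `2 * K`.
-/
lemma abs_current_le {K : ℝ} (hK : ∀ i a ξ, -K ≤ Real.log (P.trans i a ξ))
    (x : (Fin d → ℤ) × ℤ) (σ : Config d S) : |P.current x σ| ≤ K := by
  have h1 := hK x.1 (σ (x.1, x.2)) (layer (x.2 - 1) σ)
  have h2 := hK x.1 (σ (x.1, x.2 - 1)) (layer x.2 σ)
  have h3 := P.log_trans_nonpos x.1 (σ (x.1, x.2)) (layer (x.2 - 1) σ)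
  have h4 := P.log_trans_nonpos x.1 (σ (x.1, x.2 - 1)) (layer x.2 σ)
  rw [current, abs_le]
  constructor <;> linarith

/-- This is the reweighting identity: the exponential factor turns the path weight into a Boltzmann
weight that treats both time directions alike. -/
lemma neg_mul_sum_current_add (lam : ℝ) (A : Finset ((Fin d → ℤ) × ℤ)) (σ : Config d S) :
    -lam * ∑ x ∈ A, P.current x σ + ∑ x ∈ A, P.logForward x σ = ∑ x ∈ A, P.tilted lam x σ := by
  rw [Finset.mul_sum, ← Finset.sum_add_distrib]
  refine Finset.sum_congr rfl fun x _ => ?_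
  simp only [current, tilted, logForward, logBackward]
  ring

lemma tilted_add (lam : ℝ) (x v : (Fin d → ℤ) × ℤ) (σ : Config d S) :
    P.tilted lam (x + v) σ = P.tilted lam x (fun y => σ (y + v)) := by
  obtain ⟨i, n⟩ := x
  obtain ⟨j, m⟩ := v
  have h : ∀ e : Nbr d, i + j + e.1 = i + e.1 + j := fun e => by abel
  have h' : n + m - 1 = n - 1 + m := by ring
  simp only [tilted, logForward, logBackward, trans, layer, Prod.mk_add_mk, h, h']

/-- The reflection `m ↦ -1 - m` sends the pair of layers `n - 1, n` to `-n, -n - 1`, so a step into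
time `n` becomes a reversed step at time `-n`. -/
lemma tilted_timeReversal (lam : ℝ) (i : Fin d → ℤ) (n : ℤ) (σ : Config d S) :
    P.tilted lam (i, n) (fun y => σ (y.1, -1 - y.2)) = P.tilted (1 - lam) (i, -n) σ := by
  have h1 : -1 - n = -n - 1 := by ring
  have h2 : -1 - (n - 1) = -n := by ring
  simp only [tilted, logForward, logBackward, trans, layer, h1, h2]
  ring

variable [MeasurableSpace S] [MeasurableSingletonClass S]

lemma logPartition_tilted_translate (π : Measure S) [IsProbabilityMeasure π] [Nonempty S]
    (lam : ℝ) (A : Finset ((Fin d → ℤ) × ℤ)) (v : (Fin d → ℤ) × ℤ) :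
    logPartition (Measure.infinitePi fun _ => π) (P.tilted lam) (A.map (addRightEmbedding v)) =
      logPartition (Measure.infinitePi fun _ => π) (P.tilted lam) A := by
  classical
  simp only [logPartition, Finset.sum_map, addRightEmbedding_apply, tilted_add]
  congr 1
  exact integral_comp_perm_infinitePi π (Equiv.addRight v)
    (DependsOn.exp_sum fun x (_ : x ∈ A) => P.tilted_dependsOn lam x).measurable_of_finite

lemma logPartition_tilted_symm (π : Measure S) [IsProbabilityMeasure π] [Nonempty S]
    (lam : ℝ) (L N : ℤ) :
    logPartition (Measure.infinitePi fun _ => π) (P.tilted (1 - lam)) (box d L N) =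
      logPartition (Measure.infinitePi fun _ => π) (P.tilted lam) (box d L N) := by
  classical
  -- The steps in the box involve the layers `-N - 1, …, N`, a window centred at `-1/2`; hence the
  -- reflection `m ↦ -1 - m`, which acts on the steps as `n ↦ -n`.
  let e : ((Fin d → ℤ) × ℤ) ≃ ((Fin d → ℤ) × ℤ) := (Equiv.refl _).prodCongr (Equiv.subLeft (-1))
  rw [logPartition, logPartition, ← integral_comp_perm_infinitePi π e
    (DependsOn.exp_sum fun x (_ : x ∈ box d L N) => P.tilted_dependsOn lam x).measurable_of_finite]
  congr 2
  funext σ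
  congr 1
  refine Finset.sum_nbij' (fun x => (x.1, -x.2)) (fun x => (x.1, -x.2)) ?_ ?_ (by simp) (by simp) ?_
  · rintro ⟨i, n⟩ h
    simp only [box, Finset.mem_product, Finset.mem_Icc] at h ⊢
    exact ⟨h.1, by omega, by omega⟩
  · rintro ⟨i, n⟩ h
    simp only [box, Finset.mem_product, Finset.mem_Icc] at h ⊢
    exact ⟨h.1, by omega, by omega⟩
  · rintro ⟨i, n⟩ -
    have := P.tilted_timeReversal lam i (-n) σ
    rw [neg_neg] at this
    exact this.symm

end PCA

/-! ### Probabilities of space-time cylinders -/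

/-- The configurations that agree with `η` on the points of `B`. -/
def agreeOn {ι S : Type*} (B : Finset ι) (η : ι → S) : Set (ι → S) := {σ | ∀ y ∈ B, σ y = η y}

lemma measurableSet_agreeOn {ι S : Type*} [MeasurableSpace S] [MeasurableSingletonClass S]
    (B : Finset ι) (η : ι → S) {Δ : Set ι} (hB : (B : Set ι) ⊆ Δ) :
    MeasurableSet[cylinderEvents Δ] (agreeOn B η) := by
  have : agreeOn B η = ⋂ y ∈ B, (fun σ : ι → S => σ y) ⁻¹' {η y} := by
    ext σ; simp [agreeOn]
  rw [this]
  exact Finset.measurableSet_biInter B fun y hy =>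
    measurable_cylinderEvent_apply (hB hy) (measurableSet_singleton _)

namespace PCA

variable {d : ℕ} {S : Type*} [Fintype S] (P : PCA d S)

lemma prod_trans_bounds {P : PCA d S} {K : ℝ} (hK : ∀ i a ξ, -K ≤ Real.log (P.trans i a ξ))
    (V : Finset (Fin d → ℤ)) (a : (Fin d → ℤ) → S) (ξ : SpaceConfig d S) :
    Real.exp (-K * V.card) ≤ ∏ i ∈ V, P.trans i (a i) ξ ∧ ∏ i ∈ V, P.trans i (a i) ξ ≤ 1 := by
  refine ⟨?_, Finset.prod_le_one (fun i _ => (P.trans_pos _ _ _).le)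
    fun i _ => P.trans_le_one _ _ _⟩
  calc Real.exp (-K * V.card) = ∏ i ∈ V, Real.exp (-K) := by
        rw [Finset.prod_const, ← Real.exp_nat_mul, mul_comm]
    _ ≤ ∏ i ∈ V, P.trans i (a i) ξ := Finset.prod_le_prod (fun _ _ => (Real.exp_pos _).le)
        fun i _ => (Real.le_log_iff_exp_le (P.trans_pos _ _ _)).1 (hK _ _ _)

variable [MeasurableSpace S] [MeasurableSingletonClass S]
  {ρ : Measure (SpaceConfig d S)} {μ : Measure (Config d S)} [IsProbabilityMeasure μ]

lemma measurable_trans_layer [Nonempty S] (i : Fin d → ℤ) (a : S) (n : ℤ) :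
    Measurable fun σ : Config d S => P.trans i a (layer n σ) := by
  have : DependsOn (fun σ : Config d S => P.trans i a (layer n σ)) (transitionNbhd (i, n)) :=
    fun σ σ' h => congrArg (P.prob a)
      (funext fun e => h _ (nbr_add_mem_transitionNbhd (i, n) e (by simp) le_rfl))
  exact this.measurable_of_finite

variable {P}

/-- The Markov property, integrated over a cylinder event of the past. -/
lemma IsMarkovExtension.measureReal_agreeOn_succ (hμ : P.IsMarkovExtension ρ μ)
    (V : Finset (Fin d → ℤ)) (a : ℤ) (n : ℕ) (η : Config d S) :
    μ.real (agreeOn (V ×ˢ Finset.Ico a (a + ((n + 1 : ℕ) : ℤ))) η) =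
      ∫ σ in agreeOn (V ×ˢ Finset.Ico a (a + n)) η,
        ∏ i ∈ V, P.trans i (η (i, a + n)) (layer (a + n - 1) σ) ∂μ := by
  have hA := measurableSet_agreeOn (V ×ˢ Finset.Ico a (a + n)) η
    (Δ := {x : (Fin d → ℤ) × ℤ | x.2 < a + n}) (fun y hy => by
      simp only [Finset.coe_product, Set.mem_prod, Finset.coe_Ico, Set.mem_Ico] at hy
      exact hy.2.2)
  have hle : cylinderEvents {x : (Fin d → ℤ) × ℤ | x.2 < a + n} ≤
      (MeasurableSpace.pi : MeasurableSpace (Config d S)) := cylinderEvents_le_pi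
  set E : Set (Config d S) := {σ | ∀ i ∈ V, σ (i, a + n) = η (i, a + n)} with hE
  have hEm : MeasurableSet E := by
    have : E = agreeOn (V ×ˢ {a + (n : ℤ)}) η := by
      ext σ
      simp [hE, agreeOn]
    rw [this]
    exact cylinderEvents_le_pi _ (measurableSet_agreeOn _ η subset_rfl)
  have hint : Integrable (E.indicator fun _ => (1 : ℝ)) μ := (integrable_const 1).indicator hEm
  rw [← setIntegral_congr_ae (hle _ hA) ((hμ.markov (a + n) V fun i => η (i, a + n)).mono
    fun σ hσ _ => hσ), setIntegral_condExp hle hint hA, setIntegral_indicator hEm,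
    setIntegral_const, smul_eq_mul, mul_one]
  congr 1
  ext σ
  simp only [agreeOn, hE, Set.mem_inter_iff, Set.mem_ofPred_eq, Finset.mem_product, Finset.mem_Ico]
  constructor
  · intro h
    exact ⟨fun y hy => h y ⟨hy.1, hy.2.1, by push_cast; omega⟩,
      fun i hi => h (i, a + n) ⟨hi, by simp, by push_cast; omega⟩⟩
  · rintro ⟨h1, h2⟩ ⟨i, m⟩ ⟨hi, hm⟩
    rcases lt_or_ge m (a + n) with hlt | hge
    · exact h1 _ ⟨hi, hm.1, hlt⟩
    · obtain rfl : m = a + n := by push_cast at hm; omega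
      exact h2 i hi

/-- Bounds for the probability of a space-time cylinder: up to the factors of the initial layer and
of the sites outside the interior `U` of `V`, it is the product of the transition probabilities. -/
lemma IsMarkovExtension.measureReal_agreeOn_bounds [Nonempty S] (hμ : P.IsMarkovExtension ρ μ)
    {K : ℝ} (hK : ∀ i a ξ, -K ≤ Real.log (P.trans i a ξ)) {U V : Finset (Fin d → ℤ)}
    (hUV : U ⊆ V) (hnbr : ∀ i ∈ U, ∀ e : Nbr d, i + e.1 ∈ V) (a : ℤ) (η : Config d S) (n : ℕ) :
    Real.exp (-K * (V.card + ((V.card : ℝ) - U.card) * n)) *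
        Real.exp (∑ x ∈ U ×ˢ Finset.Ico (a + 1) (a + 1 + n), P.logForward x η) ≤
        μ.real (agreeOn (V ×ˢ Finset.Ico a (a + ((n + 1 : ℕ) : ℤ))) η) ∧
      μ.real (agreeOn (V ×ˢ Finset.Ico a (a + ((n + 1 : ℕ) : ℤ))) η) ≤
        Real.exp (∑ x ∈ U ×ˢ Finset.Ico (a + 1) (a + 1 + n), P.logForward x η) := by
  have hms : ∀ m : ℕ, MeasurableSet (agreeOn (V ×ˢ Finset.Ico a (a + (m : ℤ))) η) := fun m =>
    cylinderEvents_le_pi _ (measurableSet_agreeOn _ η subset_rfl)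
  have hint : ∀ m : ℤ, ∀ s : Set (Config d S), IntegrableOn
      (fun σ => ∏ i ∈ V, P.trans i (η (i, m)) (layer (m - 1) σ)) s μ := fun m s => by
    refine Integrable.of_bound (C := 1) (Measurable.aestronglyMeasurable
      (Finset.measurable_prod V fun i _ => P.measurable_trans_layer _ _ _)) (ae_of_all _ fun σ => ?_)
    have := prod_trans_bounds hK V (fun i => η (i, m)) (layer (m - 1) σ)
    rw [Real.norm_eq_abs, abs_of_nonneg ((Real.exp_pos _).le.trans this.1)]
    exact this.2
  induction n with
  | zero =>
    -- The first layer is also drawn from its predecessor, so its cylinder probability lies between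
    -- `exp (-K * V.card)` and `1` whatever `ρ` is.
    rw [hμ.measureReal_agreeOn_succ V a 0 η]
    have huniv : agreeOn (V ×ˢ Finset.Ico a (a + ((0 : ℕ) : ℤ))) η = Set.univ := by
      ext σ; simp [agreeOn]
    have hb := fun σ : Config d S => prod_trans_bounds hK V (fun i => η (i, a + ((0 : ℕ) : ℤ)))
      (layer (a + ((0 : ℕ) : ℤ) - 1) σ)
    have hi := hint (a + ((0 : ℕ) : ℤ)) Set.univ
    rw [huniv]
    rw [IntegrableOn, Measure.restrict_univ] at hi
    rw [Measure.restrict_univ]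
    simp only [Nat.cast_zero, mul_zero, add_zero, Finset.Ico_self, Finset.product_empty,
      Finset.sum_empty, Real.exp_zero, mul_one] at hb hi ⊢
    constructor
    · calc Real.exp (-K * V.card) = ∫ _, Real.exp (-K * V.card) ∂μ := by simp
        _ ≤ _ := integral_mono (integrable_const _) hi fun σ => (hb σ).1
    · calc _ ≤ ∫ _ : Config d S, (1 : ℝ) ∂μ :=
            integral_mono hi (integrable_const _) fun σ => (hb σ).2
        _ = 1 := by simp
  | succ n ih =>
    rw [hμ.measureReal_agreeOn_succ V a (n + 1) η]
    set E := agreeOn (V ×ˢ Finset.Ico a (a + ((n + 1 : ℕ) : ℤ))) η with hE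
    set m : ℤ := a + ((n + 1 : ℕ) : ℤ) with hm
    set W := Real.exp (∑ i ∈ U, P.logForward (i, m) η) with hW
    -- On `E` the previous layer is prescribed on all of `V`, hence on the neighbourhood of every
    -- site of `U`: the interior factors are constant there.
    have hU : ∀ σ ∈ E, ∏ i ∈ U, P.trans i (η (i, m)) (layer (m - 1) σ) = W := fun σ hσ => by
      rw [hW, Real.exp_sum]
      refine Finset.prod_congr rfl fun i hi => ?_
      rw [logForward, Real.exp_log (P.trans_pos _ _ _)]
      refine congrArg (P.prob _) (funext fun e => hσ (i + e.1, m - 1) ?_)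
      simp only [Finset.mem_product, Finset.mem_Ico, hm]
      exact ⟨hnbr i hi e, by push_cast; omega, by omega⟩
    have hcard : ((V \ U).card : ℝ) = (V.card : ℝ) - U.card := by
      rw [Finset.card_sdiff_of_subset hUV, Nat.cast_sub (Finset.card_le_card hUV)]
    -- Sites of `V \ U` may see values outside `V`; their factors are only bounded between `exp
    -- (-K)` and `1`.
    have hsplit : ∀ σ ∈ E, Real.exp (-K * ((V.card : ℝ) - U.card)) * W ≤
        ∏ i ∈ V, P.trans i (η (i, m)) (layer (m - 1) σ) ∧
        ∏ i ∈ V, P.trans i (η (i, m)) (layer (m - 1) σ) ≤ W := fun σ hσ => by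
      have hb := prod_trans_bounds hK (V \ U) (fun i => η (i, m)) (layer (m - 1) σ)
      rw [hcard] at hb
      rw [← Finset.prod_sdiff hUV, hU σ hσ]
      exact ⟨mul_le_mul_of_nonneg_right hb.1 (Real.exp_pos _).le,
        mul_le_of_le_one_left (Real.exp_pos _).le hb.2⟩
    have hconst : ∀ c : ℝ, ∫ _ in E, c ∂μ = μ.real E * c := fun c => by
      rw [setIntegral_const, smul_eq_mul]
    have hsum : Real.exp (∑ x ∈ U ×ˢ Finset.Ico (a + 1) (a + 1 + ((n + 1 : ℕ) : ℤ)),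
        P.logForward x η) =
        Real.exp (∑ x ∈ U ×ˢ Finset.Ico (a + 1) (a + 1 + (n : ℤ)), P.logForward x η) * W := by
      rw [hW, ← Real.exp_add, Finset.sum_product_right, Finset.sum_product_right]
      have : Finset.Ico (a + 1) (a + 1 + ((n + 1 : ℕ) : ℤ)) =
          insert m (Finset.Ico (a + 1) (a + 1 + (n : ℤ))) := by
        ext k
        simp only [Finset.mem_Ico, Finset.mem_insert, hm]
        push_cast
        omega
      rw [this, Finset.sum_insert (by simp only [Finset.mem_Ico, hm]; push_cast; omega), add_comm]
    rw [hsum]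
    set F := Real.exp (∑ x ∈ U ×ˢ Finset.Ico (a + 1) (a + 1 + (n : ℤ)), P.logForward x η)
    have hWpos : 0 < W := Real.exp_pos _
    constructor
    · calc Real.exp (-K * (V.card + ((V.card : ℝ) - U.card) * ((n + 1 : ℕ) : ℝ))) * (F * W)
          = (Real.exp (-K * (V.card + ((V.card : ℝ) - U.card) * n)) * F) *
            (Real.exp (-K * ((V.card : ℝ) - U.card)) * W) := by
            have : -K * (V.card + ((V.card : ℝ) - U.card) * ((n + 1 : ℕ) : ℝ)) =
                -K * (V.card + ((V.card : ℝ) - U.card) * n) + -K * ((V.card : ℝ) - U.card) := by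
              push_cast; ring
            rw [this, Real.exp_add]
            ring
        _ ≤ μ.real E * (Real.exp (-K * ((V.card : ℝ) - U.card)) * W) :=
          mul_le_mul_of_nonneg_right ih.1 (by positivity)
        _ = ∫ _ in E, Real.exp (-K * ((V.card : ℝ) - U.card)) * W ∂μ := (hconst _).symm
        _ ≤ _ := setIntegral_mono_on (integrableOn_const (measure_ne_top _ _)) (hint m E) (hms _)
          fun σ hσ => (hsplit σ hσ).1
    · calc _ ≤ ∫ _ in E, W ∂μ := setIntegral_mono_on (hint m E)
            (integrableOn_const (measure_ne_top _ _)) (hms _) fun σ hσ => (hsplit σ hσ).2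
        _ = μ.real E * W := hconst W
        _ ≤ F * W := mul_le_mul_of_nonneg_right ih.2 hWpos.le

end PCA

/-! ### Comparison with the partition function -/

/-- The product of the uniform measures on `S`. -/
abbrev uniformProduct (ι S : Type*) [MeasurableSpace S] : Measure (ι → S) :=
  Measure.infinitePi fun _ => uniformOn (Set.univ : Set S)

instance isProbabilityMeasure_uniformOn_univ {S : Type*} [Finite S] [Nonempty S]
    [MeasurableSpace S] [MeasurableSingletonClass S] :
    IsProbabilityMeasure (uniformOn (Set.univ : Set S)) :=
  isProbabilityMeasure_uniformOn Set.finite_univ Set.univ_nonempty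

lemma uniformProduct_real_agreeOn {ι S : Type*} [Fintype S] [Nonempty S] [MeasurableSpace S]
    [MeasurableSingletonClass S] (B : Finset ι) (η : ι → S) :
    (uniformProduct ι S).real (agreeOn B η) = ((Fintype.card S : ℝ) ^ B.card)⁻¹ := by
  have h : agreeOn B η = Set.pi B fun y => {η y} := by
    ext σ; simp [agreeOn]
  rw [h, Measure.real, Measure.infinitePi_pi _ fun _ _ => measurableSet_singleton _]
  simp [uniformOn_univ]

lemma card_piFinset_Icc (d L : ℕ) :
    (Fintype.piFinset fun _ : Fin d => Finset.Icc (-(L : ℤ)) L).card = (2 * L + 1) ^ d := by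
  rw [Fintype.card_piFinset]
  simp only [Int.card_Icc, Finset.prod_const, Finset.card_univ, Fintype.card_fin]
  congr 1
  omega

lemma card_piFinset_Icc_pred (d : ℕ) {L : ℕ} (hL : 1 ≤ L) :
    ((Fintype.piFinset fun _ : Fin d => Finset.Icc (-((L : ℤ) - 1)) ((L : ℤ) - 1)).card : ℝ) =
      (2 * (L : ℝ) - 1) ^ d := by
  have h := card_piFinset_Icc d (L - 1)
  rw [Nat.cast_sub hL, Nat.cast_one] at h
  rw [h]
  push_cast [Nat.cast_sub hL]
  ring

lemma card_box (d L N : ℕ) :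
    ((box d L N).card : ℝ) = (2 * (L : ℝ) + 1) ^ d * (2 * (N : ℝ) + 1) := by
  rw [box, Finset.card_product, card_piFinset_Icc, Int.card_Icc]
  have : ((N : ℤ) + 1 - -(N : ℤ)).toNat = 2 * N + 1 := by omega
  rw [this]
  push_cast
  ring

lemma card_box_pred (d : ℕ) {L N : ℕ} (hL : 1 ≤ L) (hN : 1 ≤ N) :
    ((box d ((L : ℤ) - 1) ((N : ℤ) - 1)).card : ℝ) =
      (2 * (L : ℝ) - 1) ^ d * (2 * (N : ℝ) - 1) := by
  rw [box, Finset.card_product, Nat.cast_mul, card_piFinset_Icc_pred d hL, Int.card_Icc]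
  have : ((N : ℤ) - 1 + 1 - -((N : ℤ) - 1)).toNat = 2 * N - 1 := by omega
  rw [this, Nat.cast_sub (by omega)]
  push_cast
  ring

/-- The number of points of the initial layer and of the lateral boundary of a space-time box. -/
def boundaryCount (d L N : ℕ) : ℝ :=
  (2 * (L : ℝ) + 1) ^ d + ((2 * (L : ℝ) + 1) ^ d - (2 * (L : ℝ) - 1) ^ d) * (2 * (N : ℝ) - 1)

namespace PCA

variable {d : ℕ} {S : Type*} [Fintype S] {P : PCA d S}
  [MeasurableSpace S] [MeasurableSingletonClass S]
  {ρ : Measure (SpaceConfig d S)} {μ : Measure (Config d S)} [IsProbabilityMeasure μ]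

/-- Comparison of the generating function with the partition function of the tilted interaction:
they differ by a boundary term. -/
lemma IsMarkovExtension.abs_logGen_sub_le [Nonempty S] (hμ : P.IsMarkovExtension ρ μ) {K : ℝ}
    (hK : ∀ i a ξ, -K ≤ Real.log (P.trans i a ξ)) (lam : ℝ) {L N : ℕ} (hL : 1 ≤ L) (hN : 1 ≤ N) :
    |P.logGen μ L N lam - ((2 * (L : ℝ) + 1) ^ d * (2 * N) * Real.log (Fintype.card S) +
      logPartition (uniformProduct _ S) (P.tilted lam) (box d ((L : ℤ) - 1) ((N : ℤ) - 1)))| ≤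
      K * boundaryCount d L N := by
  classical
  set U := Fintype.piFinset fun _ : Fin d => Finset.Icc (-((L : ℤ) - 1)) ((L : ℤ) - 1) with hU
  set V := Fintype.piFinset fun _ : Fin d => Finset.Icc (-(L : ℤ)) L with hV
  set A := box d ((L : ℤ) - 1) ((N : ℤ) - 1) with hA
  set B := V ×ˢ Finset.Ico (-(N : ℤ)) (-(N : ℤ) + ((2 * N - 1 + 1 : ℕ) : ℤ)) with hB
  -- The `2 * N - 1` steps into the times `-N + 1, …, N - 1` involve `2 * N` layers, starting with
  -- layer `-N`.
  have hAU : A = U ×ˢ Finset.Ico (-(N : ℤ) + 1) (-(N : ℤ) + 1 + ((2 * N - 1 : ℕ) : ℤ)) := by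
    rw [hA, box]
    congr 1
    ext n
    simp only [Finset.mem_Icc, Finset.mem_Ico]
    omega
  have hBcard : (B.card : ℝ) = (2 * (L : ℝ) + 1) ^ d * (2 * N) := by
    rw [hB, Finset.card_product, card_piFinset_Icc, Int.card_Ico]
    have : (-(N : ℤ) + ((2 * N - 1 + 1 : ℕ) : ℤ) - -(N : ℤ)).toNat = 2 * N := by omega
    rw [this]
    push_cast
    ring
  have hUV : U ⊆ V := fun i hi => by
    simp only [hU, hV, Fintype.mem_piFinset, Finset.mem_Icc] at hi ⊢
    exact fun k => ⟨by linarith [hi k], by linarith [hi k]⟩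
  have hnbr : ∀ i ∈ U, ∀ e : Nbr d, i + e.1 ∈ V := fun i hi e => by
    simp only [hU, hV, Fintype.mem_piFinset, Finset.mem_Icc, Pi.add_apply] at hi ⊢
    intro k
    have := abs_le.1 (e.2 k)
    exact ⟨by linarith [hi k], by linarith [hi k]⟩
  have hsub : A.biUnion transitionNbhd ⊆ B := by
    intro y hy
    obtain ⟨x, hx, hxy⟩ := Finset.mem_biUnion.1 hy
    rw [mem_transitionNbhd] at hxy
    simp only [hAU, hU, hB, hV, Finset.mem_product, Fintype.mem_piFinset, Finset.mem_Icc,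
      Finset.mem_Ico] at hx ⊢
    refine ⟨fun k => ?_, by omega, by omega⟩
    have h1 := hxy.1 k
    have h2 := hx.1 k
    omega
  have hf : DependsOn (fun σ => Real.exp (-lam * ∑ x ∈ A, P.current x σ)) B := by
    simp only [Finset.mul_sum]
    exact (DependsOn.exp_sum (h := fun x σ => -lam * P.current x σ) fun x _ => fun _ _ h =>
      congrArg (-lam * ·) (P.current_dependsOn x h)).mono (Finset.coe_subset.2 hsub)
  have hg : DependsOn (fun σ => Real.exp (∑ x ∈ A, P.tilted lam x σ)) B :=
    (DependsOn.exp_sum fun x _ => P.tilted_dependsOn lam x).mono (Finset.coe_subset.2 hsub)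
  obtain ⟨σ₀⟩ : Nonempty (Config d S) := inferInstance
  have hSpos : (0 : ℝ) < (Fintype.card S : ℝ) ^ B.card := by
    have := Fintype.card_pos (α := S)
    positivity
  have hgpos : 0 < ∫ σ, Real.exp (∑ x ∈ A, P.tilted lam x σ) ∂(uniformProduct _ S) :=
    integral_exp_pos (hg.integrable_of_finite _)
  have hfpos : 0 < ∫ σ, Real.exp (-lam * ∑ x ∈ A, P.current x σ) ∂μ :=
    integral_exp_pos (hf.integrable_of_finite _)
  -- `Z` replaces each cylinder probability by its interior path weight. It is exactly `card S ^
  -- B.card` times the uniform expectation of the tilted Boltzmann factor.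
  set Z := ∑ η : B → S, Real.exp (∑ x ∈ A, P.logForward x (Function.updateFinset σ₀ B η)) *
    Real.exp (-lam * ∑ x ∈ A, P.current x (Function.updateFinset σ₀ B η)) with hZ
  have hν : Z = (Fintype.card S : ℝ) ^ B.card *
      ∫ σ, Real.exp (∑ x ∈ A, P.tilted lam x σ) ∂(uniformProduct _ S) := by
    rw [hg.integral_eq_sum σ₀, Finset.mul_sum, hZ]
    refine Finset.sum_congr rfl fun η _ => ?_
    have h := uniformProduct_real_agreeOn B (Function.updateFinset σ₀ B η)
    rw [agreeOn] at h
    rw [h, mul_inv_cancel_left₀ hSpos.ne', ← Real.exp_add, ← P.neg_mul_sum_current_add, add_comm]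
  have hZpos : 0 < Z := hν ▸ mul_pos hSpos hgpos
  have hlogZ : Real.log Z = (2 * (L : ℝ) + 1) ^ d * (2 * N) * Real.log (Fintype.card S) +
      logPartition (uniformProduct _ S) (P.tilted lam) A := by
    rw [hν, Real.log_mul hSpos.ne' hgpos.ne', Real.log_pow, hBcard, logPartition]
  have hbd := fun η => hμ.measureReal_agreeOn_bounds hK hUV hnbr (-(N : ℤ)) η (2 * N - 1)
  have hcount : (V.card : ℝ) + ((V.card : ℝ) - U.card) * ((2 * N - 1 : ℕ) : ℝ) =
      boundaryCount d L N := by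
    rw [hV, card_piFinset_Icc, hU, card_piFinset_Icc_pred d hL, Nat.cast_sub (by omega),
      boundaryCount]
    push_cast
    ring
  rw [hcount, ← hAU, ← hB] at hbd
  have hsum := hf.integral_eq_sum σ₀ μ
  have hupper : ∫ σ, Real.exp (-lam * ∑ x ∈ A, P.current x σ) ∂μ ≤ Z := by
    rw [hsum]
    exact Finset.sum_le_sum fun η _ =>
      mul_le_mul_of_nonneg_right (hbd _).2 (Real.exp_pos _).le
  have hlower : Real.exp (-K * boundaryCount d L N) * Z ≤
      ∫ σ, Real.exp (-lam * ∑ x ∈ A, P.current x σ) ∂μ := by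
    rw [hsum, hZ, Finset.mul_sum]
    refine Finset.sum_le_sum fun η _ => ?_
    rw [← mul_assoc]
    exact mul_le_mul_of_nonneg_right (hbd _).1 (Real.exp_pos _).le
  have h1 := Real.log_le_log hfpos hupper
  have h2 := Real.log_le_log (mul_pos (Real.exp_pos _) hZpos) hlower
  rw [Real.log_mul (Real.exp_pos _).ne' hZpos.ne', Real.log_exp] at h2
  have h3 : P.logGen μ L N lam = Real.log (∫ σ, Real.exp (-lam * ∑ x ∈ A, P.current x σ) ∂μ) := rfl
  rw [← hlogZ, h3, abs_le]
  constructor <;> linarith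

/-- Both generating functions are compared with the same quantity, since the partition function is
symmetric; this doubles the error. -/
lemma IsMarkovExtension.abs_logGen_sub_logGen_le [Nonempty S] (hμ : P.IsMarkovExtension ρ μ)
    {K : ℝ} (hK : ∀ i a ξ, -K ≤ Real.log (P.trans i a ξ)) (lam : ℝ) {L N : ℕ} (hL : 1 ≤ L)
    (hN : 1 ≤ N) :
    |P.logGen μ L N lam - P.logGen μ L N (1 - lam)| ≤ 2 * K * boundaryCount d L N := by
  have h1 := abs_le.1 (hμ.abs_logGen_sub_le hK lam hL hN)
  have h2 := abs_le.1 (hμ.abs_logGen_sub_le hK (1 - lam) hL hN)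
  rw [P.logPartition_tilted_symm] at h2
  rw [abs_le]
  constructor <;> linarith

lemma abs_logGen_le [Nonempty S] {K : ℝ} (hK : ∀ i a ξ, -K ≤ Real.log (P.trans i a ξ))
    (μ : Measure (Config d S)) [IsProbabilityMeasure μ] (lam : ℝ) {L N : ℕ} (hL : 1 ≤ L)
    (hN : 1 ≤ N) :
    |P.logGen μ L N lam| ≤ |lam| * K * ((2 * (L : ℝ) - 1) ^ d * (2 * (N : ℝ) - 1)) := by
  classical
  rw [← card_box_pred d hL hN, logGen]
  set A := box d ((L : ℤ) - 1) ((N : ℤ) - 1)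
  have hb : ∀ σ, |-lam * ∑ x ∈ A, P.current x σ| ≤ |lam| * K * A.card := fun σ => by
    rw [abs_mul, abs_neg, mul_assoc]
    refine mul_le_mul_of_nonneg_left ?_ (abs_nonneg _)
    calc |∑ x ∈ A, P.current x σ| ≤ ∑ x ∈ A, |P.current x σ| := Finset.abs_sum_le_sum_abs _ _
      _ ≤ ∑ x ∈ A, K := Finset.sum_le_sum fun x _ => P.abs_current_le hK x σ
      _ = K * A.card := by rw [Finset.sum_const, nsmul_eq_mul, mul_comm]
  have hint : Integrable (fun σ => Real.exp (-lam * ∑ x ∈ A, P.current x σ)) μ := by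
    simp only [Finset.mul_sum]
    exact (DependsOn.exp_sum (h := fun x σ => -lam * P.current x σ) fun x _ => fun _ _ h =>
      congrArg (-lam * ·) (P.current_dependsOn x h)).integrable_of_finite μ
  have hpos := integral_exp_pos hint
  rw [abs_le]
  constructor
  · rw [Real.le_log_iff_exp_le hpos]
    calc _ = ∫ _ : Config d S, Real.exp (-(|lam| * K * A.card)) ∂μ := by simp
      _ ≤ _ := integral_mono (integrable_const _) hint fun σ =>
        Real.exp_le_exp.2 (abs_le.1 (hb σ)).1
  · rw [Real.log_le_iff_le_exp hpos]
    calc _ ≤ ∫ _ : Config d S, Real.exp (|lam| * K * A.card) ∂μ :=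
          integral_mono hint (integrable_const _) fun σ => Real.exp_le_exp.2 (abs_le.1 (hb σ)).2
      _ = _ := by simp

end PCA

/-! ### Size of the boundary -/

/-- Bernoulli's inequality for the lateral boundary of a cube. -/
lemma pow_sub_pow_mul_le (d : ℕ) {L : ℝ} (hL : 1 ≤ L) :
    ((2 * L + 1) ^ d - (2 * L - 1) ^ d) * L ≤ d * (3 * L) ^ d := by
  have hpos : 0 < 2 * L + 1 := by linarith
  -- The ratio `(2 * L - 1) / (2 * L + 1)` equals `1 + a` for this `a`.
  have hb := one_add_mul_le_pow (a := -2 / (2 * L + 1)) (by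
    rw [le_div_iff₀ hpos]; linarith) d
  have h2 : (1 + -2 / (2 * L + 1)) ^ d * (2 * L + 1) ^ d = (2 * L - 1) ^ d := by
    rw [← mul_pow]; congr 1; field_simp; ring
  have h3 : (2 * L + 1) ^ d - (2 * L - 1) ^ d ≤ (2 * L + 1) ^ d * (d * 2 / (2 * L + 1)) := by
    rw [← h2]
    have := mul_le_mul_of_nonneg_right hb (pow_pos hpos d).le
    have e : (1 + (d : ℝ) * (-2 / (2 * L + 1))) * (2 * L + 1) ^ d =
      (2 * L + 1) ^ d - (2 * L + 1) ^ d * (d * 2 / (2 * L + 1)) := by ring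
    linarith
  have h4 : (d : ℝ) * 2 / (2 * L + 1) * L ≤ d := by
    rw [div_mul_eq_mul_div, div_le_iff₀ hpos]
    nlinarith [(Nat.cast_nonneg d : (0 : ℝ) ≤ d)]
  have h5 : (2 * L + 1) ^ d ≤ (3 * L) ^ d := pow_le_pow_left₀ hpos.le (by linarith) d
  calc ((2 * L + 1) ^ d - (2 * L - 1) ^ d) * L
      ≤ (2 * L + 1) ^ d * (d * 2 / (2 * L + 1)) * L :=
        mul_le_mul_of_nonneg_right h3 (by linarith)
    _ = (2 * L + 1) ^ d * (d * 2 / (2 * L + 1) * L) := by ring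
    _ ≤ (2 * L + 1) ^ d * d := mul_le_mul_of_nonneg_left h4 (pow_pos hpos d).le
    _ ≤ (3 * L) ^ d * d := mul_le_mul_of_nonneg_right h5 (Nat.cast_nonneg d)
    _ = _ := mul_comm _ _

/-- The lateral boundary has order `L ^ (d - 1)` per unit of time. The initial layer, of order `L ^
d`, is absorbed because `L ≤ N`. The integer exponent covers `d = 0`. -/
lemma boundaryCount_le {d L N : ℕ} (hL : 1 ≤ L) (hLN : L ≤ N) :
    boundaryCount d L N ≤ N * (3 ^ d * (1 + 2 * d) * (L : ℝ) ^ ((d : ℤ) - 1)) := by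
  have hL1 : (1 : ℝ) ≤ L := by exact_mod_cast hL
  have hLN1 : (L : ℝ) ≤ N := by exact_mod_cast hLN
  have hL0 : (0 : ℝ) < L := by linarith
  have hz : (L : ℝ) ^ ((d : ℤ) - 1) * L = (L : ℝ) ^ d := by
    rw [← zpow_add_one₀ hL0.ne']; simp
  refine le_of_mul_le_mul_right ?_ hL0
  have h1 := pow_sub_pow_mul_le d hL1
  have h5 : (2 * (L : ℝ) + 1) ^ d ≤ (3 * L) ^ d := pow_le_pow_left₀ (by linarith) (by linarith) d
  have h6 : (0 : ℝ) ≤ (3 * (L : ℝ)) ^ d := by positivity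
  calc boundaryCount d L N * L
      = (2 * (L : ℝ) + 1) ^ d * L +
        ((2 * (L : ℝ) + 1) ^ d - (2 * (L : ℝ) - 1) ^ d) * L * (2 * (N : ℝ) - 1) := by
        rw [boundaryCount]; ring
    _ ≤ (3 * (L : ℝ)) ^ d * N + d * (3 * (L : ℝ)) ^ d * (2 * N) := by
        refine add_le_add (mul_le_mul h5 hLN1 hL0.le h6) ?_
        refine (mul_le_mul_of_nonneg_right h1 (by linarith)).trans ?_
        exact mul_le_mul_of_nonneg_left (by linarith) (by positivity)
    _ = N * (3 ^ d * (1 + 2 * d) * (L : ℝ) ^ ((d : ℤ) - 1)) * L := by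
        rw [mul_pow, ← hz]; ring

/-! ### Packing a box with separated cubes -/

/-- The space-time cube of side `k` with its lowest corner at `(k + 2) • t`. -/
def block {d : ℕ} (k : ℕ) (t : (Fin d → ℤ) × ℤ) : Finset ((Fin d → ℤ) × ℤ) :=
  ((Fintype.piFinset fun _ : Fin d => Finset.Ico (0 : ℤ) k) ×ˢ Finset.Ico (0 : ℤ) k).map
    (addRightEmbedding (((k : ℤ) + 2) • t))

/-- The positions of a grid of blocks. -/
def blockIndices (d : ℕ) (r s : ℕ) : Finset ((Fin d → ℤ) × ℤ) :=
  (Fintype.piFinset fun _ : Fin d => Finset.Ico (-(r : ℤ)) r) ×ˢ Finset.Ico (-(s : ℤ)) s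

lemma mem_block {d k : ℕ} {t x : (Fin d → ℤ) × ℤ} :
    x ∈ block k t ↔
      (∀ j, ((k : ℤ) + 2) * t.1 j ≤ x.1 j ∧ x.1 j < ((k : ℤ) + 2) * t.1 j + k) ∧
        ((k : ℤ) + 2) * t.2 ≤ x.2 ∧ x.2 < ((k : ℤ) + 2) * t.2 + k := by
  simp only [block, Finset.mem_map, Finset.mem_product, Fintype.mem_piFinset, Finset.mem_Ico,
    addRightEmbedding_apply]
  constructor
  · rintro ⟨y, ⟨h1, h2⟩, rfl⟩
    simp only [Prod.fst_add, Prod.snd_add, Prod.smul_fst, Prod.smul_snd, Pi.add_apply,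
      Pi.smul_apply, smul_eq_mul]
    exact ⟨fun j => ⟨by linarith [h1 j], by linarith [h1 j]⟩, by linarith, by linarith⟩
  · rintro ⟨h1, h2⟩
    refine ⟨x - ((k : ℤ) + 2) • t, ⟨fun j => ?_, ?_⟩, by simp⟩
    · simp only [Prod.fst_sub, Prod.smul_fst, Pi.sub_apply, Pi.smul_apply, smul_eq_mul]
      exact ⟨by linarith [h1 j], by linarith [h1 j]⟩
    · simp only [Prod.snd_sub, Prod.smul_snd, smul_eq_mul]
      exact ⟨by linarith, by linarith⟩

lemma card_block {d : ℕ} (k : ℕ) (t : (Fin d → ℤ) × ℤ) : (block k t).card = k ^ (d + 1) := by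
  simp [block, Fintype.card_piFinset, pow_succ]

lemma card_blockIndices (d r s : ℕ) : (blockIndices d r s).card = (2 * r) ^ d * (2 * s) := by
  have h : ∀ r : ℕ, ((r : ℤ) - -(r : ℤ)).toNat = 2 * r := fun r => by omega
  simp only [blockIndices, Finset.card_product, Fintype.card_piFinset, Int.card_Ico, h,
    Finset.prod_const, Finset.card_univ, Fintype.card_fin]

lemma ediv_eq_of_mem_block {m t y : ℤ} (hm : 0 < m) (h1 : m * t ≤ y + 1) (h2 : y + 1 < m * t + m) :
    (y + 1) / m = t := by
  rw [Int.ediv_eq_iff_of_pos hm]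
  constructor <;> linarith

/-- The transition neighbourhoods of different blocks are disjoint. -/
lemma pairwiseDisjoint_block_nbhd {d : ℕ} (k : ℕ) (T : Set ((Fin d → ℤ) × ℤ)) :
    T.PairwiseDisjoint fun t => (block k t).biUnion transitionNbhd := by
  -- Neighbourhoods extend a cube by at most one on each side, so the corridors of width two make
  -- the index `t` recoverable from any point by integer division.
  have key : ∀ t y : (Fin d → ℤ) × ℤ, y ∈ (block k t).biUnion transitionNbhd →
      t = (fun j => (y.1 j + 1) / ((k : ℤ) + 2), (y.2 + 1) / ((k : ℤ) + 2)) := by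
    intro t y hy
    obtain ⟨x, hx, hxy⟩ := Finset.mem_biUnion.1 hy
    rw [mem_transitionNbhd] at hxy
    rw [mem_block] at hx
    refine Prod.ext (funext fun j => ?_) ?_
    · have h1 := hx.1 j
      have h2 := hxy.1 j
      exact (ediv_eq_of_mem_block (by omega) (by linarith) (by linarith)).symm
    · exact (ediv_eq_of_mem_block (by omega) (by linarith) (by linarith)).symm
  intro t _ t' _ hne
  exact Finset.disjoint_left.2 fun y hy hy' => hne ((key t y hy).trans (key t' y hy').symm)

lemma block_subset_nbhd {d : ℕ} (k : ℕ) (t : (Fin d → ℤ) × ℤ) :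
    block k t ⊆ (block k t).biUnion transitionNbhd := fun x hx =>
  Finset.mem_biUnion.2 ⟨x, hx, mem_transitionNbhd_of_fst_eq x (by simp) le_rfl⟩

lemma biUnion_block_subset_box {d k r s : ℕ} {L N : ℤ} (hL : ((k : ℤ) + 2) * r ≤ L)
    (hN : ((k : ℤ) + 2) * s ≤ N) : (blockIndices d r s).biUnion (block k) ⊆ box d L N := by
  have key : ∀ {r : ℕ} {L t x : ℤ}, ((k : ℤ) + 2) * r ≤ L → -(r : ℤ) ≤ t → t < r →
      ((k : ℤ) + 2) * t ≤ x → x < ((k : ℤ) + 2) * t + k → -L ≤ x ∧ x ≤ L := by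
    intro r L t x h1 h2 h3 h4 h5
    have hk : (0 : ℤ) ≤ (k : ℤ) + 2 := by omega
    have h6 := mul_le_mul_of_nonneg_left h2 hk
    have h7 := mul_le_mul_of_nonneg_left (Int.add_one_le_of_lt h3) hk
    constructor <;> linarith
  intro x hx
  obtain ⟨t, ht, hxt⟩ := Finset.mem_biUnion.1 hx
  simp only [blockIndices, Finset.mem_product, Fintype.mem_piFinset, Finset.mem_Ico] at ht
  rw [mem_block] at hxt
  simp only [box, Finset.mem_product, Fintype.mem_piFinset, Finset.mem_Icc]
  exact ⟨fun j => key hL (ht.1 j).1 (ht.1 j).2 (hxt.1 j).1 (hxt.1 j).2,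
    key hN ht.2.1 ht.2.2 hxt.2.1 hxt.2.2⟩

namespace PCA

variable {d : ℕ} {S : Type*} [Fintype S] (P : PCA d S)
  [MeasurableSpace S] [MeasurableSingletonClass S] [Nonempty S]

/-- Disjoint neighbourhoods make the block factors independent under the product measure, and
translation invariance makes their integrals equal. -/
lemma logPartition_biUnion_block (lam : ℝ) (k : ℕ) (T : Finset ((Fin d → ℤ) × ℤ)) :
    logPartition (uniformProduct _ S) (P.tilted lam) (T.biUnion (block k)) =
      T.card * logPartition (uniformProduct _ S) (P.tilted lam) (block k 0) := by
  classical
  have hdisj : (T : Set ((Fin d → ℤ) × ℤ)).PairwiseDisjoint (block k) :=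
    (pairwiseDisjoint_block_nbhd k _).mono (block_subset_nbhd k)
  have htrans : ∀ t, logPartition (uniformProduct _ S) (P.tilted lam) (block k t) =
      logPartition (uniformProduct _ S) (P.tilted lam) (block k 0) := fun t => by
    rw [block, block, P.logPartition_tilted_translate, P.logPartition_tilted_translate]
  have hdep : ∀ t ∈ T, DependsOn (fun σ => Real.exp (∑ x ∈ block k t, P.tilted lam x σ))
      ((block k t).biUnion transitionNbhd) := fun t _ =>
    DependsOn.exp_sum fun x _ => P.tilted_dependsOn lam x
  have hint := integral_prod_of_dependsOn (fun _ => uniformOn (Set.univ : Set S)) T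
    (fun t => (block k t).biUnion transitionNbhd) (pairwiseDisjoint_block_nbhd k _)
    (fun t σ => Real.exp (∑ x ∈ block k t, P.tilted lam x σ)) hdep
  rw [logPartition]
  simp only [Finset.sum_biUnion hdisj, Real.exp_sum T]
  rw [hint, Real.log_prod fun t ht =>
    (integral_exp_pos ((hdep t ht).integrable_of_finite _)).ne']
  calc _ = ∑ t ∈ T, logPartition (uniformProduct _ S) (P.tilted lam) (block k t) := rfl
    _ = _ := by simp only [htrans, Finset.sum_const, nsmul_eq_mul]

/-- The error is the bound on the interaction times the number of points of the box outside the
cubes. -/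
lemma abs_logPartition_box_sub_le {K : ℝ} (hK : ∀ i a ξ, -K ≤ Real.log (P.trans i a ξ))
    (lam : ℝ) {k r s : ℕ} {L N : ℤ} (hL : ((k : ℤ) + 2) * r ≤ L) (hN : ((k : ℤ) + 2) * s ≤ N) :
    |logPartition (uniformProduct _ S) (P.tilted lam) (box d L N) -
      (2 * (r : ℝ)) ^ d * (2 * s) *
        logPartition (uniformProduct _ S) (P.tilted lam) (block k 0)| ≤
      (|1 - lam| + |lam|) * K *
        ((box d L N).card - (2 * (r : ℝ)) ^ d * (2 * s) * (k : ℝ) ^ (d + 1)) := by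
  classical
  have h := logPartition_sub_le (uniformProduct _ S) (P.tilted_dependsOn lam)
    (P.abs_tilted_le hK lam) (biUnion_block_subset_box (d := d) hL hN)
  have hdisj : (blockIndices d r s : Set ((Fin d → ℤ) × ℤ)).PairwiseDisjoint (block k) :=
    (pairwiseDisjoint_block_nbhd k _).mono (block_subset_nbhd k)
  rw [P.logPartition_biUnion_block, Finset.card_biUnion hdisj] at h
  simp only [card_block, Finset.sum_const, card_blockIndices, smul_eq_mul] at h
  push_cast at h
  exact h

end PCA

/-! ### Limits per volume -/

/-- A function that is eventually squeezed, up to errors with small limits, between convergent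
functions is convergent. -/
lemma exists_tendsto_of_abs_sub_le {α : Type*} {l : Filter α} [l.NeBot] {u : α → ℝ}
    {v w : ℕ → α → ℝ} {g δ : ℕ → ℝ} (huv : ∀ k, ∀ᶠ x in l, |u x - v k x| ≤ w k x)
    (hv : ∀ k, Tendsto (v k) l (𝓝 (g k))) (hw : ∀ k, Tendsto (w k) l (𝓝 (δ k)))
    (hδ : Tendsto δ atTop (𝓝 0)) : ∃ e, Tendsto u l (𝓝 e) := by
  refine cauchy_map_iff_exists_tendsto.1 (Metric.cauchy_iff.2 ⟨inferInstance, fun ε hε => ?_⟩)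
  -- A single `k` with small `δ k` suffices: `u` eventually stays near `g k`, which gives the Cauchy
  -- property without knowing that `g` converges.
  obtain ⟨k, hk⟩ := (hδ.eventually (gt_mem_nhds (by positivity : (0 : ℝ) < ε / 4))).exists
  have h1 := (hw k).eventually (gt_mem_nhds hk)
  have h2 := (hv k).eventually (Metric.ball_mem_nhds (g k) (by positivity : (0 : ℝ) < ε / 4))
  have h3 : ∀ᶠ x in l, |u x - g k| < ε / 2 := by
    filter_upwards [huv k, h1, h2] with x a b c
    rw [Real.dist_eq] at c
    calc |u x - g k| ≤ |u x - v k x| + |v k x - g k| := abs_sub_le _ _ _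
      _ < ε / 2 := by linarith
  refine ⟨u '' {x | |u x - g k| < ε / 2}, image_mem_map h3, ?_⟩
  rintro _ ⟨x, hx, rfl⟩ _ ⟨y, hy, rfl⟩
  rw [Real.dist_eq]
  simp only [Set.mem_ofPred_eq] at hx hy
  rw [abs_sub_comm] at hy
  calc |u x - u y| ≤ |u x - g k| + |g k - u y| := abs_sub_le _ _ _
    _ < ε := by linarith

lemma tendsto_two_mul_add_one_inv :
    Tendsto (fun n : ℕ => 1 / (2 * (n : ℝ) + 1)) atTop (𝓝 0) := by
  have h : Tendsto (fun n : ℕ => 2 * (n : ℝ) + 1) atTop atTop :=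
    tendsto_atTop_add_const_right _ _ (tendsto_natCast_atTop_atTop.const_mul_atTop (by norm_num))
  simp only [one_div]
  exact h.inv_tendsto_atTop

lemma tendsto_two_mul_sub_one_div :
    Tendsto (fun n : ℕ => (2 * (n : ℝ) - 1) / (2 * (n : ℝ) + 1)) atTop (𝓝 1) := by
  have h := (tendsto_two_mul_add_one_inv.const_mul 2).const_sub 1
  rw [mul_zero, sub_zero] at h
  refine h.congr fun n => ?_
  have : (2 * (n : ℝ) + 1) ≠ 0 := by positivity
  field_simp
  ring

lemma tendsto_two_mul_div_two_mul_add_one :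
    Tendsto (fun n : ℕ => (2 * (n : ℝ)) / (2 * (n : ℝ) + 1)) atTop (𝓝 1) := by
  have h := tendsto_two_mul_add_one_inv.const_sub 1
  rw [sub_zero] at h
  refine h.congr fun n => ?_
  have : (2 * (n : ℝ) + 1) ≠ 0 := by positivity
  field_simp
  ring

lemma tendsto_two_mul_nat_div {m : ℕ} (hm : 0 < m) :
    Tendsto (fun n : ℕ => (2 * (((n - 1) / m : ℕ) : ℝ)) / (2 * (n : ℝ) + 1)) atTop
      (𝓝 (1 / m)) := by
  have hm' : (0 : ℝ) < m := by exact_mod_cast hm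
  have h0 := tendsto_two_mul_add_one_inv
  -- Since `n < m * ((n - 1) / m) + m + 1`, any constant of at least `3 + 2 * m` in place of `5 + 2
  -- * m` gives a lower bound.
  have hl : Tendsto (fun n : ℕ => 1 / (m : ℝ) - (5 + 2 * m) / m * (1 / (2 * (n : ℝ) + 1))) atTop
      (𝓝 (1 / m)) := by
    simpa using (h0.const_mul ((5 + 2 * (m : ℝ)) / m)).const_sub (1 / (m : ℝ))
  refine tendsto_of_tendsto_of_tendsto_of_le_of_le hl tendsto_const_nhds (fun n => ?_) fun n => ?_
  · have hpos : (0 : ℝ) < 2 * (n : ℝ) + 1 := by positivity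
    have h1 : n - 1 < m * ((n - 1) / m) + m := by
      have := Nat.div_add_mod (n - 1) m
      have := Nat.mod_lt (n - 1) hm
      omega
    have h2 : n < m * ((n - 1) / m) + m + 1 := by omega
    have h3 : (n : ℝ) < m * (((n - 1) / m : ℕ) : ℝ) + m + 1 := by exact_mod_cast h2
    rw [le_div_iff₀ hpos]
    have e : (1 / (m : ℝ) - (5 + 2 * m) / m * (1 / (2 * (n : ℝ) + 1))) * (2 * (n : ℝ) + 1) =
        (2 * n + 1 - (5 + 2 * m)) / m := by field_simp
    rw [e, div_le_iff₀ hm']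
    linarith
  · have hpos : (0 : ℝ) < 2 * (n : ℝ) + 1 := by positivity
    have h1 : m * ((n - 1) / m) ≤ n := (Nat.mul_div_le _ _).trans (Nat.sub_le _ _)
    have h2 : (m : ℝ) * (((n - 1) / m : ℕ) : ℝ) ≤ n := by exact_mod_cast h1
    rw [div_le_div_iff₀ hpos hm']
    linarith

namespace PCA

variable {d : ℕ} {S : Type*} [Fintype S] (P : PCA d S)
  [MeasurableSpace S] [MeasurableSingletonClass S] [Nonempty S]

/-- Existence of the thermodynamic limit of the pressure of the tilted interaction. -/
lemma exists_tendsto_logPartition_div_card (lam : ℝ) :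
    ∃ e : ℝ, Tendsto (fun q : ℕ × ℕ => logPartition (uniformProduct _ S) (P.tilted lam)
      (box d ((q.1 : ℤ) - 1) ((q.2 : ℤ) - 1)) / ((box d q.1 q.2).card : ℝ))
      (atTop ×ˢ atTop) (𝓝 e) := by
  obtain ⟨K, -, hK⟩ := P.exists_log_trans_bound
  set C := (|1 - lam| + |lam|) * K
  set f : ℕ → ℝ := fun k => logPartition (uniformProduct _ S) (P.tilted lam)
    (block k (0 : (Fin d → ℤ) × ℤ))
  let b : ℕ → ℕ → ℝ := fun k n => (2 * (((n - 1) / (k + 2) : ℕ) : ℝ)) / (2 * (n : ℝ) + 1)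
  let a : ℕ → ℝ := fun n => (2 * (n : ℝ) - 1) / (2 * (n : ℝ) + 1)
  -- `D k q` is the number of cubes of side `k` packed into the smaller box, per point of the larger
  -- one.
  let D : ℕ → ℕ × ℕ → ℝ := fun k q => b k q.1 ^ d * b k q.2
  have hD : ∀ k, Tendsto (D k) (atTop ×ˢ atTop) (𝓝 ((1 / ((k + 2 : ℕ) : ℝ)) ^ (d + 1))) := fun k => by
    have h := tendsto_two_mul_nat_div (Nat.succ_pos (k + 1))
    rw [pow_succ]
    exact ((h.comp tendsto_fst).pow d).mul (h.comp tendsto_snd)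
  have hA : Tendsto (fun q : ℕ × ℕ => a q.1 ^ d * a q.2) (atTop ×ˢ atTop) (𝓝 1) := by
    have h := tendsto_two_mul_sub_one_div
    simpa using ((h.comp tendsto_fst).pow d).mul (h.comp tendsto_snd)
  -- The limiting density of points outside the cubes is `1 - (k / (k + 2)) ^ (d + 1)`, which
  -- vanishes as `k` grows.
  refine exists_tendsto_of_abs_sub_le (v := fun k q => D k q * f k)
    (w := fun k q => C * (a q.1 ^ d * a q.2 - D k q * (k : ℝ) ^ (d + 1)))
    (δ := fun k => C * (1 - (1 / ((k + 2 : ℕ) : ℝ)) ^ (d + 1) * (k : ℝ) ^ (d + 1)))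
    (fun k => ?_) (fun k => (hD k).mul_const _)
    (fun k => (hA.sub ((hD k).mul_const _)).const_mul C) ?_
  · filter_upwards [(eventually_ge_atTop 1).prod_mk (eventually_ge_atTop 1)] with q hq
    obtain ⟨L, N⟩ := q
    obtain ⟨hL, hN⟩ : 1 ≤ L ∧ 1 ≤ N := hq
    have hdiv : ∀ n : ℕ, 1 ≤ n → ((k : ℤ) + 2) * (((n - 1) / (k + 2) : ℕ) : ℤ) ≤ (n : ℤ) - 1 := by
      intro n hn
      have := Nat.mul_div_le (n - 1) (k + 2)
      have h2 : (((k + 2) * ((n - 1) / (k + 2)) : ℕ) : ℤ) ≤ ((n - 1 : ℕ) : ℤ) := by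
        exact_mod_cast this
      rw [Nat.cast_sub hn] at h2
      push_cast at h2 ⊢
      exact h2
    have h := P.abs_logPartition_box_sub_le hK lam (hdiv L hL) (hdiv N hN)
    have hL0 : (0 : ℝ) < 2 * (L : ℝ) + 1 := by positivity
    have hN0 : (0 : ℝ) < 2 * (N : ℝ) + 1 := by positivity
    have hc : 0 < (2 * (L : ℝ) + 1) ^ d * (2 * (N : ℝ) + 1) := by positivity
    rw [card_box_pred d hL hN] at h
    have h' := div_le_div_of_nonneg_right h hc.le
    rw [← abs_of_pos hc, ← abs_div, abs_of_pos hc] at h'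
    simp only [D, a, b, f, card_box, div_pow]
    refine (le_of_eq_of_le ?_ h').trans_eq ?_
    · congr 1
      field_simp
    · change _ = (|1 - lam| + |lam|) * K * _
      field_simp
  · have h : Tendsto (fun k : ℕ => ((k : ℝ) / ((k : ℝ) + 2)) ^ (d + 1)) atTop (𝓝 1) := by
      simpa using (tendsto_natCast_div_add_atTop (2 : ℝ)).pow (d + 1)
    have h2 := (h.const_sub 1).const_mul C
    rw [sub_self, mul_zero] at h2
    refine h2.congr fun k => ?_
    rw [← mul_pow]
    push_cast
    congr 3
    ring

end PCA

/-- Boundary terms are negligible with respect to the volume. -/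
lemma tendsto_boundaryCount_div_card (d : ℕ) :
    Tendsto (fun q : ℕ × ℕ => boundaryCount d q.1 q.2 / ((box d q.1 q.2).card : ℝ))
      (atTop ×ˢ atTop) (𝓝 0) := by
  have h0 := tendsto_two_mul_add_one_inv.comp (tendsto_snd (f := (atTop : Filter ℕ)))
  have h1 := tendsto_two_mul_sub_one_div
  have h := h0.add ((((h1.comp tendsto_fst).pow d).const_sub 1).mul (h1.comp tendsto_snd))
  simp only [one_pow, sub_self, zero_mul, add_zero] at h
  refine h.congr fun q => ?_
  have hL : (2 * (q.1 : ℝ) + 1) ≠ 0 := by positivity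
  have hN : (2 * (q.2 : ℝ) + 1) ≠ 0 := by positivity
  simp only [Function.comp_apply, card_box, boundaryCount, div_pow]
  field_simp

/-! ### Growth rate and finite-size bounds for the generating function -/

namespace PCA

variable {d : ℕ} {S : Type*} [Fintype S] {P : PCA d S}
  [MeasurableSpace S] [MeasurableSingletonClass S]
  {ρ : Measure (SpaceConfig d S)} {μ : Measure (Config d S)} [IsProbabilityMeasure μ]

/-- The generating function has an exponential growth rate in the volume. -/
lemma IsMarkovExtension.exists_tendsto_logGen_div_card [Nonempty S]
    (hμ : P.IsMarkovExtension ρ μ) (lam : ℝ) :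
    ∃ e : ℝ, Tendsto (fun q : ℕ × ℕ => P.logGen μ q.1 q.2 lam / ((box d q.1 q.2).card : ℝ))
      (atTop ×ˢ atTop) (𝓝 e) := by
  obtain ⟨K, -, hK⟩ := P.exists_log_trans_bound
  obtain ⟨e, he⟩ := P.exists_tendsto_logPartition_div_card lam
  have hv : Tendsto (fun q : ℕ × ℕ => (2 * (q.2 : ℝ)) / (2 * (q.2 : ℝ) + 1) *
      Real.log (Fintype.card S)) (atTop ×ˢ atTop) (𝓝 (1 * Real.log (Fintype.card S))) :=
    (tendsto_two_mul_div_two_mul_add_one.comp tendsto_snd).mul_const _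
  have hb : Tendsto (fun q : ℕ × ℕ => K * (boundaryCount d q.1 q.2 / ((box d q.1 q.2).card : ℝ)))
      (atTop ×ˢ atTop) (𝓝 0) := by
    simpa using (tendsto_boundaryCount_div_card d).const_mul K
  refine ⟨_, tendsto_of_tendsto_of_dist (hv.add he) (squeeze_zero' (Eventually.of_forall fun _ =>
    dist_nonneg) ?_ hb)⟩
  filter_upwards [(eventually_ge_atTop 1).prod_mk (eventually_ge_atTop 1)] with q hq
  have h := hμ.abs_logGen_sub_le hK lam hq.1 hq.2
  have hc : (0 : ℝ) < (box d q.1 q.2).card := by rw [card_box]; positivity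
  have h' := div_le_div_of_nonneg_right h hc.le
  rw [dist_comm, Real.dist_eq, ← mul_div_assoc]
  rw [← abs_of_pos hc, ← abs_div, abs_of_pos hc] at h'
  refine le_of_eq_of_le ?_ h'
  congr 1
  have hL : (2 * (q.1 : ℝ) + 1) ≠ 0 := by positivity
  have hN : (2 * (q.2 : ℝ) + 1) ≠ 0 := by positivity
  rw [card_box]
  field_simp

lemma IsMarkovExtension.tendsto_logGen_sub_div_card [Nonempty S]
    (hμ : P.IsMarkovExtension ρ μ) (lam : ℝ) :
    Tendsto (fun q : ℕ × ℕ => P.logGen μ q.1 q.2 lam / ((box d q.1 q.2).card : ℝ) -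
      P.logGen μ q.1 q.2 (1 - lam) / ((box d q.1 q.2).card : ℝ)) (atTop ×ˢ atTop) (𝓝 0) := by
  obtain ⟨K, -, hK⟩ := P.exists_log_trans_bound
  have hb : Tendsto (fun q : ℕ × ℕ =>
      2 * K * (boundaryCount d q.1 q.2 / ((box d q.1 q.2).card : ℝ)))
      (atTop ×ˢ atTop) (𝓝 0) := by
    simpa using (tendsto_boundaryCount_div_card d).const_mul (2 * K)
  refine squeeze_zero_norm' ?_ hb
  filter_upwards [(eventually_ge_atTop 1).prod_mk (eventually_ge_atTop 1)] with q hq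
  have h := hμ.abs_logGen_sub_logGen_le hK lam hq.1 hq.2
  have hc : (0 : ℝ) < (box d q.1 q.2).card := by rw [card_box]; positivity
  rw [← sub_div, Real.norm_eq_abs, abs_div, abs_of_pos hc, ← mul_div_assoc]
  exact div_le_div_of_nonneg_right h hc.le

lemma abs_eLN_le [Nonempty S] {K : ℝ} (hK : ∀ i a ξ, -K ≤ Real.log (P.trans i a ξ))
    (μ : Measure (Config d S)) [IsProbabilityMeasure μ] (hK0 : 0 ≤ K) (lam : ℝ) {L N : ℕ}
    (hL : 1 ≤ L) (hLN : L ≤ N) :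
    |P.eLN μ L N lam| ≤ 2 * |lam| * K * 2 ^ d * (L : ℝ) ^ d := by
  have hL1 : (1 : ℝ) ≤ L := by exact_mod_cast hL
  have hN1 : (1 : ℝ) ≤ N := by exact_mod_cast hL.trans hLN
  have hN0 : (0 : ℝ) < N := by linarith
  rw [eLN, neg_mul, abs_neg, abs_mul, abs_of_pos (one_div_pos.2 hN0), div_mul_eq_mul_div, one_mul,
    div_le_iff₀ hN0]
  calc |P.logGen μ L N lam| ≤ |lam| * K * ((2 * (L : ℝ) - 1) ^ d * (2 * (N : ℝ) - 1)) :=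
        abs_logGen_le hK μ lam hL (hL.trans hLN)
    _ ≤ |lam| * K * ((2 * (L : ℝ)) ^ d * (2 * N)) := by
        refine mul_le_mul_of_nonneg_left ?_ (by positivity)
        exact mul_le_mul (pow_le_pow_left₀ (by linarith) (by linarith) d) (by linarith)
          (by linarith) (by positivity)
    _ = _ := by rw [mul_pow]; ring

lemma IsMarkovExtension.abs_eLN_sub_eLN_le [Nonempty S] (hμ : P.IsMarkovExtension ρ μ) {K : ℝ}
    (hK : ∀ i a ξ, -K ≤ Real.log (P.trans i a ξ)) (hK0 : 0 ≤ K) (lam : ℝ) {L N : ℕ} (hL : 1 ≤ L)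
    (hLN : L ≤ N) :
    |P.eLN μ L N lam - P.eLN μ L N (1 - lam)| ≤
      2 * K * (3 ^ d * (1 + 2 * d)) * (L : ℝ) ^ ((d : ℤ) - 1) := by
  have hN0 : (0 : ℝ) < N := by exact_mod_cast hL.trans hLN
  rw [eLN, eLN, ← mul_sub, neg_mul, abs_neg, abs_mul, abs_of_pos (one_div_pos.2 hN0),
    div_mul_eq_mul_div, one_mul, div_le_iff₀ hN0]
  calc _ ≤ 2 * K * boundaryCount d L N := hμ.abs_logGen_sub_logGen_le hK lam hL (hL.trans hLN)
    _ ≤ 2 * K * (N * (3 ^ d * (1 + 2 * d) * (L : ℝ) ^ ((d : ℤ) - 1))) :=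
        mul_le_mul_of_nonneg_left (boundaryCount_le hL hLN) (by positivity)
    _ = _ := by ring

end PCA

end

theorem theorem2 {d : ℕ} {S : Type*} [Fintype S] [MeasurableSpace S] [MeasurableSingletonClass S]
    (P : PCA d S) :
    ∃ c c' : ℝ → ℝ,
      ∀ (ρ : Measure (SpaceConfig d S)) (μ : Measure (Config d S))
        [IsProbabilityMeasure ρ] [IsProbabilityMeasure μ],
        IsTranslationInvariant ρ → P.IsStationary ρ → P.IsMarkovExtension ρ μ →
        (∃ e : ℝ → ℝ,
          (∀ L : ℕ → ℕ, (∀ N, L N ≤ N) → Tendsto L atTop atTop → ∀ lam : ℝ,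
            Tendsto (fun N : ℕ =>
              -(1 / ((box d (L N : ℤ) (N : ℤ)).card : ℝ)) * P.logGen μ (L N) N lam)
              atTop (𝓝 (e lam))) ∧
          ∀ lam : ℝ, e lam = e (1 - lam)) ∧
        ∀ (lam : ℝ) (L N : ℕ), 1 ≤ L → L ≤ N →
          |P.eLN μ L N lam| ≤ c' lam * (L : ℝ) ^ d ∧
          |P.eLN μ L N lam - P.eLN μ L N (1 - lam)| ≤ c lam * (L : ℝ) ^ ((d : ℤ) - 1) := by
  obtain ⟨K, hK0, hK⟩ := P.exists_log_trans_bound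
  refine ⟨fun _ => 2 * K * (3 ^ d * (1 + 2 * d)), fun lam => 2 * |lam| * K * 2 ^ d, ?_⟩
  intro ρ μ _ _ _ _ hμ
  obtain ⟨σ₀⟩ : Nonempty (Config d S) := nonempty_of_isProbabilityMeasure μ
  have : Nonempty S := ⟨σ₀ 0⟩
  refine ⟨?_, fun lam L N hL hLN =>
    ⟨PCA.abs_eLN_le hK μ hK0 lam hL hLN, hμ.abs_eLN_sub_eLN_le hK hK0 lam hL hLN⟩⟩
  choose p hp using hμ.exists_tendsto_logGen_div_card
  refine ⟨fun lam => -p lam, fun L _ hL lam => ?_, fun lam => ?_⟩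
  · refine ((hp lam).comp (hL.prodMk tendsto_id)).neg.congr fun N => ?_
    simp only [Function.comp_apply, id_eq]
    ring
  · have h := tendsto_nhds_unique ((hp lam).sub (hp (1 - lam))) (hμ.tendsto_logGen_sub_div_card lam)
    simp only [neg_inj]
    linarith
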